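/- Let $\Gamma$ be a finite perfect group (that is, $\Gamma$ has no non-trivial abelian quotient; equivalently $[\Gamma,\Gamma]=\Gamma$), and let $\mathbb{G}=\widehat{\Gamma}$ be its dual quantum group: $C(\mathbb{G})=\mathbb{C}[\Gamma]$ with $g^*=g^{-1}$, comultiplication $\Delta(g)=g\otimes g$ and antipode $S(g)=g^{-1}$ for $g\in\Gamma$, regarded as a finite quantum set through the functional $\psi\bigl(\sum_g c_g g\bigr)=|\Gamma|\,c_1$. With the inner product $\langle x,y\rangle=\psi(x^*y)$, the multiplication $m$ satisfies $mm^*=\mathrm{id}$. A (directed) quantum graph on $\mathbb{G}$ is a linear map $A:C(\mathbb{G})\to C(\mathbb{G})$ with $m(A\otimes A)m^*=A$ and $A(f^*)^*=A(f)$ for all $f$. Then there is a quantum graph $A$ on $\mathbb{G}$ with the following properties. 1. It is a quantum Cayley graph: there is an orthogonal projection $P\in C(\mathbb{G})$ with $A(x)=P\star x:=(\psi(S(P)\,\cdot\,)\otimes\mathrm{id})\Delta(x)$ for all $x\in C(\mathbb{G})$. 2. Its classical automorphism group is trivial: the identity is the only $*$-automorphism of $C(\mathbb{G})$ that commutes with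 $A$. 3. Its quantum automorphism group is $\widehat{\Gamma}$, acting on $C(\mathbb{G})$ by $\Delta$. That is, $\Delta$ is a faithful action of $\widehat{\Gamma}$ on $C(\mathbb{G})$ that preserves $\psi$ and commutes with $A$, meaning $(\psi\otimes\mathrm{id})\Delta=\psi(\cdot)1$ and $(A\otimes\mathrm{id})\Delta=\Delta A$. Moreover, for every compact quantum group $\mathbb{H}$ and every action $\beta:C(\mathbb{G})\to C(\mathbb{G})\otimes\mathcal{O}(\mathbb{H})$ that preserves $\psi$ and commutes with $A$ in the same sense, there is a unique Hopf $*$-algebra morphism $\gamma:\mathbb{C}[\Gamma]\to\mathcal{O}(\mathbb{H})$ with $(\mathrm{id}\otimes\gamma)\Delta=\beta$. 4. This action of the quantum automorphism group is ergodic (transitive): $\{x\in C(\mathbb{G}):\Delta(x)=x\otimes 1\}=\mathbb{C}1$. -/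

import Mathlib

open scoped TensorProduct

universe u v

noncomputable section

/-! ### Finite quantum sets and quantum graphs -/

section QuantumSets

open scoped ComplexOrder

/-- A finite quantum set: a finite-dimensional unital complex `*`-algebra `B = C(𝕏)` with its
tracial `1`-form `ψ`, i.e. a tracial faithful positive functional such that `m m^* = id`, where
`m : B ⊗ B → B` is the multiplication and `m^*` is its adjoint for the inner products
`⟨x, y⟩ = ψ (x^* y)` on `B` and `⟨x ⊗ y, x' ⊗ y'⟩ = ψ (x^* x') ψ (y^* y')` on `B ⊗ B`.
(A finite-dimensional `*`-algebra with a faithful positive functional is a C*-algebra for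
a unique norm; `mulAdj` is determined by `ψ` because the inner product is non-degenerate.) -/
structure QuantumSet (B : Type*) [Ring B] [StarRing B] [Algebra ℂ B] [StarModule ℂ B] where
  finiteDimensional : FiniteDimensional ℂ B
  /-- the tracial `1`-form -/
  ψ : B →ₗ[ℂ] ℂ
  tracial : ∀ x y : B, ψ (x * y) = ψ (y * x)
  pos : ∀ x : B, x ≠ 0 → 0 < ψ (star x * x)
  /-- the adjoint `m^*` of the multiplication -/
  mulAdj : B →ₗ[ℂ] B ⊗[ℂ] B
  mulAdj_adjoint : ∀ x y z : B,
    LinearMap.mul' ℂ ℂ (TensorProduct.map ψ ψ (star (x ⊗ₜ[ℂ] y) * mulAdj z))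
      = ψ (star (x * y) * z)
  mul_mulAdj : ∀ z : B, LinearMap.mul' ℂ B (mulAdj z) = z

variable {B : Type*} [Ring B] [StarRing B] [Algebra ℂ B] [StarModule ℂ B]

/-- The Schur product `S • T = m (S ⊗ T) m^*`. -/
def QuantumSet.schur (X : QuantumSet B) (S T : B →ₗ[ℂ] B) : B →ₗ[ℂ] B :=
  LinearMap.mul' ℂ B ∘ₗ TensorProduct.map S T ∘ₗ X.mulAdj

/-- A (directed) quantum graph on the quantum set `X`: a quantum adjacency matrix, i.e. a
Schur idempotent `A` that is real, `A f = (A (f^*))^*`. -/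
structure QuantumGraph (X : QuantumSet B) where
  A : B →ₗ[ℂ] B
  schur_idempotent : X.schur A A = A
  real : ∀ f : B, star (A (star f)) = A f

/-- The classical automorphism group of a quantum graph: the `*`-automorphisms of `C(𝕏)` that
commute with the quantum adjacency matrix. -/
def QuantumGraph.classicalAut {X : QuantumSet B} (G : QuantumGraph X) :
    Subgroup (B ≃⋆ₐ[ℂ] B) where
  carrier := {θ | ∀ x, θ (G.A x) = G.A (θ x)}
  one_mem' := fun _ => rfl
  mul_mem' := by
    intro a b ha hb x
    change ∀ x, a (G.A x) = G.A (a x) at ha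
    change ∀ x, b (G.A x) = G.A (b x) at hb
    rw [StarAlgEquiv.mul_apply, StarAlgEquiv.mul_apply, hb, ha]
  inv_mem' := by
    intro a ha x
    change ∀ x, a (G.A x) = G.A (a x) at ha
    change a.symm (G.A x) = G.A (a.symm x)
    have h := ha (a.symm x)
    rw [StarAlgEquiv.apply_symm_apply] at h
    rw [← h, StarAlgEquiv.symm_apply_apply]

end QuantumSets

/-! ### Compact quantum groups and their actions -/

/-- A unitary `n × n` matrix over a Hopf `*`-algebra `H` that is a (co)representation:
`Δ (u i j) = ∑ k, u i k ⊗ u k j`. -/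
structure IsUnitaryCorep {H : Type*} [Ring H] [StarRing H] [HopfAlgebra ℂ H]
    {n : ℕ} (u : Matrix (Fin n) (Fin n) H) : Prop where
  comul : ∀ i j, Coalgebra.comul (R := ℂ) (u i j) = ∑ k, u i k ⊗ₜ[ℂ] u k j
  unitary : u ∈ unitary (Matrix (Fin n) (Fin n) H)

/-- `H = 𝒪(ℍ)` is a CQG-Hopf `*`-algebra, i.e. the algebra of a compact quantum group `ℍ`:
a Hopf `*`-algebra spanned by the matrix coefficients of its unitary finite-dimensional
(co)representations. -/
class IsCompactQuantumGroup (H : Type*) [Ring H] [StarRing H] [HopfAlgebra ℂ H]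
    [StarModule ℂ H] : Prop where
  comul_star : ∀ x : H, Coalgebra.comul (R := ℂ) (star x) = star (Coalgebra.comul (R := ℂ) x)
  counit_star : ∀ x : H,
    Coalgebra.counit (R := ℂ) (star x) = star (Coalgebra.counit (R := ℂ) x)
  span_coeff : Submodule.span ℂ {x : H | ∃ (n : ℕ) (u : Matrix (Fin n) (Fin n) H),
    IsUnitaryCorep u ∧ ∃ i j, x = u i j} = ⊤

section Actions

variable {B : Type*} [Ring B] [StarRing B] [Algebra ℂ B] [StarModule ℂ B]
  {H : Type*} [Ring H] [StarRing H] [HopfAlgebra ℂ H] [StarModule ℂ H]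

/-- An action of the compact quantum group with algebra `H` on the algebra `B`: an injective unital
`*`-homomorphism `α : B → B ⊗ H` with `(α ⊗ id) α = (id ⊗ Δ) α`. -/
structure QuantumAction (B H : Type*) [Ring B] [StarRing B] [Algebra ℂ B] [StarModule ℂ B]
    [Ring H] [StarRing H] [HopfAlgebra ℂ H] [StarModule ℂ H] where
  hom : B →⋆ₐ[ℂ] B ⊗[ℂ] H
  injective : Function.Injective hom
  action_eq : ∀ x : B,
    TensorProduct.assoc ℂ B H H (LinearMap.rTensor H hom.toAlgHom.toLinearMap (hom x))
      = LinearMap.lTensor B (Coalgebra.comul (R := ℂ) (A := H)) (hom x)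

/-- The action is faithful: the slices `(ω ⊗ id) (α a)` generate `H` as a Hopf `*`-algebra. -/
def QuantumAction.IsFaithful (α : QuantumAction B H) : Prop :=
  ∀ S : StarSubalgebra ℂ H,
    (∀ (ω : B →ₗ[ℂ] ℂ) (a : B), TensorProduct.lid ℂ H (LinearMap.rTensor H ω (α.hom a)) ∈ S) →
    (∀ x ∈ S, HopfAlgebra.antipode ℂ x ∈ S) →
    (∀ x ∈ S, Coalgebra.comul (R := ℂ) x ∈ LinearMap.range
      (TensorProduct.map S.subtype.toAlgHom.toLinearMap S.subtype.toAlgHom.toLinearMap)) →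
    S = ⊤

/-- The action is ergodic (transitive): its fixed point algebra is `ℂ 1`. -/
def QuantumAction.IsErgodic (α : QuantumAction B H) : Prop :=
  {x : B | α.hom x = x ⊗ₜ[ℂ] (1 : H)} = Set.range (algebraMap ℂ B)

/-- The action `α` on `C(𝕏)` is an action on the quantum graph `G`: it preserves `ψ`,
`(ψ ⊗ id) α = ψ(·) 1`, and the adjacency matrix, `(A ⊗ id) α = α A`. -/
structure QuantumGraph.IsPreservedBy {X : QuantumSet B} (G : QuantumGraph X)
    (α : QuantumAction B H) : Prop where
  functional : ∀ x : B,
    TensorProduct.lid ℂ H (LinearMap.rTensor H X.ψ (α.hom x)) = X.ψ x • (1 : H)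
  adjacency : ∀ x : B, LinearMap.rTensor H G.A (α.hom x) = α.hom (G.A x)

end Actions

/-- The compact quantum group with algebra `H`, acting by `α`, is the quantum automorphism group
of the quantum graph `G`: it acts faithfully on `G`, and for every action `β` of a compact quantum
group, with algebra `K`, on `G` there is a unique Hopf `*`-algebra morphism `γ : H → K` with
`(id ⊗ γ) α = β`. (A bialgebra morphism between Hopf algebras preserves the antipode.) -/
structure QuantumGraph.IsQuantumAutGroup.{w, u₁, u₂} {B : Type u₁} [Ring B] [StarRing B]
    [Algebra ℂ B] [StarModule ℂ B] {X : QuantumSet B} (G : QuantumGraph X)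
    {H : Type u₂} [Ring H] [StarRing H] [HopfAlgebra ℂ H] [StarModule ℂ H]
    (α : QuantumAction B H) : Prop where
  compactQuantumGroup : IsCompactQuantumGroup H
  preserved : G.IsPreservedBy α
  faithful : α.IsFaithful
  universal : ∀ (K : Type w) [Ring K] [StarRing K] [HopfAlgebra ℂ K] [StarModule ℂ K]
    [IsCompactQuantumGroup K] (β : QuantumAction B K), G.IsPreservedBy β →
    ∃! γ : H →ₐc[ℂ] K, (∀ x, γ (star x) = star (γ x)) ∧
      ∀ x, LinearMap.lTensor B (γ : H →ₗ[ℂ] K) (α.hom x) = β.hom x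

/-! ### Finite quantum groups: action on themselves, convolution, Cayley graphs -/

section QuantumGroups

variable {H : Type*} [Ring H] [StarRing H] [HopfAlgebra ℂ H] [StarModule ℂ H]

/-- The action of a quantum group on itself, given by the comultiplication. -/
def QuantumAction.regular (H : Type*) [Ring H] [StarRing H] [HopfAlgebra ℂ H] [StarModule ℂ H]
    [IsCompactQuantumGroup H] : QuantumAction H H where
  hom := { Bialgebra.comulAlgHom ℂ H with
    map_star' := fun x => IsCompactQuantumGroup.comul_star x }
  injective := by
    intro x y hxy
    have hxy' : Coalgebra.comul (R := ℂ) x = Coalgebra.comul (R := ℂ) y := hxy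
    have h := congrArg (fun z => TensorProduct.lid ℂ H
      (LinearMap.rTensor H (Coalgebra.counit (R := ℂ) (A := H)) z)) hxy'
    simpa using h
  action_eq := fun x => Coalgebra.coassoc_apply (R := ℂ) x

/-- The convolution operator `L_ω = (ω ⊗ id) Δ`. -/
def leftConv (ω : H →ₗ[ℂ] ℂ) : H →ₗ[ℂ] H :=
  (TensorProduct.lid ℂ H).toLinearMap ∘ₗ LinearMap.rTensor H ω ∘ₗ Coalgebra.comul

/-- The functional `ψ_x : y ↦ ψ (x y)`. -/
def QuantumSet.density (X : QuantumSet H) (x : H) : H →ₗ[ℂ] ℂ :=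
  X.ψ ∘ₗ LinearMap.mulLeft ℂ x

/-- The operator `x ⋆ ·` of convolution by `x`, that is, `L_{ψ_{S(x)}}`. -/
def QuantumSet.convolution (X : QuantumSet H) (x : H) : H →ₗ[ℂ] H :=
  leftConv (X.density (HopfAlgebra.antipode ℂ x))

/-- A quantum Cayley graph: the quantum adjacency matrix is `x ↦ P ⋆ x` for an orthogonal
projection `P` in the algebra. -/
def QuantumGraph.IsCayley {X : QuantumSet H} (G : QuantumGraph X) : Prop :=
  ∃ P : H, IsStarProjection P ∧ G.A = X.convolution P

end QuantumGroups

/-! ### The dual of a finite group -/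

section Dual

open scoped ComplexOrder

variable {Γ : Type*} [Group Γ]

/-- The involution of the group algebra: `(∑ c_g g)^* = ∑ conj(c_g) g⁻¹`. -/
instance groupAlgebraStar : Star (MonoidAlgebra ℂ Γ) where
  star x := .ofCoeff ((x.coeff.mapRange star (star_zero ℂ)).equivMapDomain (Equiv.inv Γ))

theorem groupAlgebra_coeff_star (x : MonoidAlgebra ℂ Γ) (g : Γ) :
    (star x).coeff g = star (x.coeff g⁻¹) := rfl

theorem groupAlgebra_star_single (g : Γ) (c : ℂ) :
    star (MonoidAlgebra.single g c) = MonoidAlgebra.single g⁻¹ (star c) := by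
  classical
  ext h
  rw [groupAlgebra_coeff_star, MonoidAlgebra.coeff_single, MonoidAlgebra.coeff_single,
    Finsupp.single_apply, Finsupp.single_apply]
  by_cases hg : g = h⁻¹
  · simp [hg]
  · have hg' : ¬ g⁻¹ = h := fun e => hg (by rw [← e, inv_inv])
    simp [hg, hg']

theorem groupAlgebra_star_add (x y : MonoidAlgebra ℂ Γ) : star (x + y) = star x + star y := by
  ext g
  simp [groupAlgebra_coeff_star]

theorem groupAlgebra_star_zero : star (0 : MonoidAlgebra ℂ Γ) = 0 := by
  ext g
  simp [groupAlgebra_coeff_star]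

instance groupAlgebraStarRing : StarRing (MonoidAlgebra ℂ Γ) where
  star_involutive x := by
    ext g
    simp [groupAlgebra_coeff_star]
  star_add := groupAlgebra_star_add
  star_mul x y := by
    induction x using MonoidAlgebra.induction_linear with
    | zero => simp [groupAlgebra_star_zero]
    | add x x' hx hx' => rw [add_mul, groupAlgebra_star_add, hx, hx', groupAlgebra_star_add, mul_add]
    | single g c =>
      induction y using MonoidAlgebra.induction_linear with
      | zero => simp [groupAlgebra_star_zero]
      | add y y' hy hy' =>
        rw [mul_add, groupAlgebra_star_add, hy, hy', groupAlgebra_star_add, add_mul]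
      | single h d =>
        simp [groupAlgebra_star_single, MonoidAlgebra.single_mul_single, mul_comm]

instance groupAlgebraStarModule : StarModule ℂ (MonoidAlgebra ℂ Γ) where
  star_smul c x := by
    ext g
    simp [groupAlgebra_coeff_star]

/-- The group algebra `ℂ[Γ]`, with Mathlib's Hopf algebra structure (`Δ g = g ⊗ g`, `ε g = 1`,
`S g = g⁻¹`), is the algebra of a compact quantum group, the dual of `Γ`. -/
instance groupAlgebra_isCompactQuantumGroup : IsCompactQuantumGroup (MonoidAlgebra ℂ Γ) where
  comul_star x := by
    induction x using MonoidAlgebra.induction_linear with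
    | zero => simp
    | add x y hx hy => simp only [star_add, map_add, hx, hy]
    | single g c => simp [groupAlgebra_star_single]
  counit_star x := by
    induction x using MonoidAlgebra.induction_linear with
    | zero => simp
    | add x y hx hy => simp only [star_add, map_add, hx, hy]
    | single g c => simp [groupAlgebra_star_single]
  span_coeff := by
    rw [eq_top_iff, ← (MonoidAlgebra.basis Γ ℂ).span_eq, Submodule.span_le]
    rintro _ ⟨g, rfl⟩
    refine Submodule.subset_span ⟨1, Matrix.of fun _ _ => MonoidAlgebra.single g 1, ⟨?_, ?_⟩, 0, 0, ?_⟩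
    · intro i j
      simp
    · rw [Unitary.mem_iff]
      constructor <;>
      · ext i j : 2
        rw [Subsingleton.elim j i, Matrix.one_apply_eq, MonoidAlgebra.one_def]
        simp [Matrix.mul_apply, Matrix.star_apply, groupAlgebra_star_single,
          MonoidAlgebra.single_mul_single]
    · simp [MonoidAlgebra.basis_apply]

/-- The Haar functional `∑ c_g g ↦ |Γ| c_1` of the dual of a finite group `Γ`, normalised to be
a `1`-form. -/
def dualHaar (Γ : Type*) [Group Γ] [Fintype Γ] : MonoidAlgebra ℂ Γ →ₗ[ℂ] ℂ :=
  (Fintype.card Γ : ℂ) • (MonoidAlgebra.basis Γ ℂ).coord 1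

/-- The map `g ↦ |Γ|⁻¹ ∑ h, h ⊗ h⁻¹ g`. -/
def dualMulAdj (Γ : Type*) [Group Γ] [Fintype Γ] :
    MonoidAlgebra ℂ Γ →ₗ[ℂ] MonoidAlgebra ℂ Γ ⊗[ℂ] MonoidAlgebra ℂ Γ :=
  (MonoidAlgebra.basis Γ ℂ).constr ℂ fun g => (Fintype.card Γ : ℂ)⁻¹ • ∑ h : Γ,
    MonoidAlgebra.single h (1 : ℂ) ⊗ₜ[ℂ] MonoidAlgebra.single (h⁻¹ * g) (1 : ℂ)

variable [Fintype Γ]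

theorem dualHaar_apply (x : MonoidAlgebra ℂ Γ) :
    dualHaar Γ x = (Fintype.card Γ : ℂ) * x.coeff 1 := rfl

theorem dualHaar_single [DecidableEq Γ] (g : Γ) (c : ℂ) :
    dualHaar Γ (MonoidAlgebra.single g c) = if g = 1 then (Fintype.card Γ : ℂ) * c else 0 := by
  rw [dualHaar_apply, MonoidAlgebra.coeff_single, Finsupp.single_apply, mul_ite, mul_zero]

theorem dualMulAdj_single (g : Γ) (c : ℂ) :
    dualMulAdj Γ (MonoidAlgebra.single g c) = c • (Fintype.card Γ : ℂ)⁻¹ • ∑ h : Γ,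
      MonoidAlgebra.single h (1 : ℂ) ⊗ₜ[ℂ] MonoidAlgebra.single (h⁻¹ * g) (1 : ℂ) := by
  have h : MonoidAlgebra.single g c = c • MonoidAlgebra.basis Γ ℂ g := by
    simp [MonoidAlgebra.basis_apply]
  rw [h, map_smul, dualMulAdj, Module.Basis.constr_basis]

theorem dualHaar_pos (x : MonoidAlgebra ℂ Γ) (hx : x ≠ 0) : 0 < dualHaar Γ (star x * x) := by
  classical
  have h1 : (star x * x).coeff 1 = ((∑ g : Γ, ‖x.coeff g‖ ^ 2 : ℝ) : ℂ) := by
    rw [MonoidAlgebra.coeff_mul_apply_right, Finsupp.sum_fintype _ _ (by simp)]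
    simp [groupAlgebra_coeff_star, Complex.conj_mul']
  have h2 : 0 < ∑ g : Γ, ‖x.coeff g‖ ^ 2 := by
    refine Finset.sum_pos' (fun g _ => by positivity) ?_
    by_contra! hc
    apply hx
    ext g
    have := hc g (Finset.mem_univ g)
    simpa using this
  rw [dualHaar_apply, h1]
  have h3 : (0 : ℝ) < Fintype.card Γ := by exact_mod_cast Fintype.card_pos
  exact_mod_cast mul_pos h3 h2

/-- The dual of a finite group `Γ` as a quantum set: the algebra `ℂ[Γ]` with the normalised Haar
functional. -/
def dualQuantumSet (Γ : Type*) [Group Γ] [Fintype Γ] : QuantumSet (MonoidAlgebra ℂ Γ) where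
  finiteDimensional := Module.Finite.of_basis (MonoidAlgebra.basis Γ ℂ)
  ψ := dualHaar Γ
  tracial x y := by
    classical
    induction x using MonoidAlgebra.induction_linear with
    | zero => simp
    | add x x' hx hx' => simp only [add_mul, mul_add, map_add, hx, hx']
    | single g c =>
      induction y using MonoidAlgebra.induction_linear with
      | zero => simp
      | add y y' hy hy' => simp only [add_mul, mul_add, map_add, hy, hy']
      | single h d =>
        simp only [MonoidAlgebra.single_mul_single, dualHaar_single, mul_comm d c,
          mul_eq_one_iff_eq_inv, eq_comm (a := h), inv_eq_iff_eq_inv]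
  pos := dualHaar_pos
  mulAdj := dualMulAdj Γ
  mulAdj_adjoint x y z := by
    classical
    induction z using MonoidAlgebra.induction_linear with
    | zero => simp
    | add z z' hz hz' => simp only [mul_add, map_add, hz, hz']
    | single k c =>
    induction x using MonoidAlgebra.induction_linear with
    | zero => simp
    | add x x' hx hx' =>
      simp only [TensorProduct.add_tmul, star_add, add_mul, map_add, hx, hx']
    | single g a =>
    induction y using MonoidAlgebra.induction_linear with
    | zero => simp
    | add y y' hy hy' =>
      simp only [TensorProduct.tmul_add, star_add, add_mul, mul_add, map_add, hy, hy']
    | single h b =>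
    have hcard : (Fintype.card Γ : ℂ) ≠ 0 := by exact_mod_cast Fintype.card_ne_zero
    simp only [dualMulAdj_single, TensorProduct.star_tmul, groupAlgebra_star_single,
      Algebra.mul_smul_comm, Finset.mul_sum, Algebra.TensorProduct.tmul_mul_tmul, map_smul,
      map_sum, TensorProduct.map_tmul, LinearMap.mul'_apply, MonoidAlgebra.single_mul_single,
      dualHaar_single, mul_one]
    rw [Finset.sum_eq_single g]
    · simp only [inv_mul_cancel, if_true, mul_inv_rev, mul_assoc]
      split_ifs
      · simp [smul_eq_mul]
        field_simp
      · simp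
    · intro l _ hl
      rw [if_neg, zero_mul]
      intro e
      exact hl (inv_mul_eq_one.mp e).symm
    · simp
  mul_mulAdj z := by
    induction z using MonoidAlgebra.induction_linear with
    | zero => simp
    | add z z' hz hz' => simp only [map_add, hz, hz']
    | single k c =>
      have hcard : (Fintype.card Γ : ℂ) ≠ 0 := by exact_mod_cast Fintype.card_ne_zero
      simp [dualMulAdj_single, MonoidAlgebra.single_mul_single, hcard]

end Dual

end

/-! Convolution by a projection `p` of `ℂ[Γ]` is the Fourier multiplier `g ↦ |Γ| p_g g`. The
equations `p * p = p` and `star p = p`, read on coefficients, say that it is a Schur idempotent and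
real. Suppose the coefficient of `p` at each non-central `g` differs from all its other
coefficients. An action `β` commuting with the multiplier then has `β g = g ⊗ a_g` for `g`
non-central, and also for `g` central, since a central element is a product of two non-central ones
unless `Γ` is abelian, hence trivial by perfectness. The `a_g` are multiplicative and group-like,
which is the morphism `γ` (`exists_eq_single_tmul`, `existsUnique_bialgHom`). For a classical
automorphism the `a_g` are scalars, so they form a character of `Γ`, and a perfect group has only
the trivial one.

It remains to find `p`, that is, to have `ψ (p z) ≠ 0` for the finitely many elements `z = g⁻¹ -
h⁻¹` with `g` non-central and `h ≠ g`; none of these `z` is central. This is a genericity argument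
(`QuantumSet.exists_projection_forall_ne_zero`). Let `p` be neither `0` nor `1` in any matrix block
of size at least two, expressed without blocks as maximality of the dimension of `B p B (1 - p) B`.
Conjugating `p` by unitaries `phase r w` keeps this property, and `w * ψ (rotate r p w * z)` is a
polynomial in `w`. If `ψ (· z)` vanished on all rotated projections that are good for the earlier
elements, comparing coefficients would make `z` commute first with `p`, then with every `[b, p]`,
and finally with everything. -/

/-! ### The ideal generated by the off-diagonal corner of an idempotent -/

section MixedIdeal

variable {B : Type*} [Ring B] [Algebra ℂ B]

/-- The two-sided ideal `B p B (1 - p) B`. -/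
def mixedIdeal (p : B) : Submodule ℂ B :=
  Submodule.span ℂ {x | ∃ a b c : B, x = a * p * b * (1 - p) * c}

theorem mem_mixedIdeal (p a b c : B) : a * p * b * (1 - p) * c ∈ mixedIdeal p :=
  Submodule.subset_span ⟨a, b, c, rfl⟩

theorem mul_mem_mixedIdeal (p b : B) : ∀ x ∈ mixedIdeal p, b * x ∈ mixedIdeal p := by
  intro x hx
  induction hx using Submodule.span_induction with
  | mem x hx =>
    obtain ⟨a, d, c, rfl⟩ := hx
    have := mem_mixedIdeal p (b * a) d c
    simpa only [mul_assoc] using this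
  | zero => simp
  | add x y _ _ hx hy => rw [mul_add]; exact add_mem hx hy
  | smul t x _ hx => rw [mul_smul_comm]; exact Submodule.smul_mem _ _ hx

theorem mem_mixedIdeal_mul (p b : B) : ∀ x ∈ mixedIdeal p, x * b ∈ mixedIdeal p := by
  intro x hx
  induction hx using Submodule.span_induction with
  | mem x hx =>
    obtain ⟨a, d, c, rfl⟩ := hx
    have := mem_mixedIdeal p a d (c * b)
    simpa only [mul_assoc] using this
  | zero => simp
  | add x y _ _ hx hy => rw [add_mul]; exact add_mem hx hy
  | smul t x _ hx => rw [smul_mul_assoc]; exact Submodule.smul_mem _ _ hx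

/-- Rotating a projection by a unitary therefore cannot lower the dimension of its mixed ideal, so
maximality survives rotation. -/
theorem mixedIdeal_le_conj {p u v : B} (hu : v * u = 1) :
    mixedIdeal p ≤ mixedIdeal (u * p * v) := by
  refine Submodule.span_le.mpr ?_
  rintro _ ⟨a, b, c, rfl⟩
  have h1 : p = v * (u * p * v) * u := by
    rw [← mul_assoc, ← mul_assoc, hu, one_mul, mul_assoc, hu, mul_one]
  have h2 : 1 - p = v * (1 - u * p * v) * u := by
    rw [mul_sub, sub_mul, ← h1, mul_one, hu]
  have h3 : a * p * b * (1 - p) * c = (a * v) * (u * p * v) * (u * b * v) *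
      (1 - u * p * v) * (u * c) := by
    conv_lhs => rw [h2]
    conv_lhs => enter [1, 1, 1]; rw [h1]
    simp only [mul_assoc]
  rw [SetLike.mem_coe, h3]
  exact mem_mixedIdeal _ _ _ _

/-- For `b` in an off-diagonal corner, `b * p - p * b` is `b` up to sign, so `z` commutes with both
off-diagonal corners. These corners and their products span the mixed ideal. -/
theorem commute_mixedIdeal {p z : B} (hp : p * p = p)
    (hz' : ∀ b, Commute z (b * p - p * b)) : ∀ x ∈ mixedIdeal p, Commute z x := by
  have h1 : ∀ b, Commute z (p * b * (1 - p)) := fun b => by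
    have h := (hz' (p * b * (1 - p))).neg_right
    have e : -(p * b * (1 - p) * p - p * (p * b * (1 - p))) = p * b * (1 - p) := by
      have e1 : (1 - p) * p = 0 := by rw [sub_mul, one_mul, hp, sub_self]
      have e2 : p * (p * b * (1 - p)) = p * b * (1 - p) := by simp only [← mul_assoc, hp]
      rw [e2, mul_assoc _ _ p, e1, mul_zero, zero_sub, neg_neg]
    rwa [e] at h
  have h2 : ∀ b, Commute z ((1 - p) * b * p) := fun b => by
    have h := hz' ((1 - p) * b * p)
    have e : (1 - p) * b * p * p - p * ((1 - p) * b * p) = (1 - p) * b * p := by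
      have e1 : p * (1 - p) = 0 := by rw [mul_sub, mul_one, hp, sub_self]
      rw [mul_assoc _ p p, hp, ← mul_assoc, ← mul_assoc, e1, zero_mul, zero_mul, sub_zero]
    rwa [e] at h
  intro x hx
  induction hx using Submodule.span_induction with
  | mem x hx =>
    obtain ⟨a, b, c, rfl⟩ := hx
    have hq : (1 - p) * (1 - p) = 1 - p := by
      rw [mul_sub, mul_one, sub_mul, one_mul, hp, sub_self, sub_zero]
    -- Peirce decomposition: the two diagonal corners of the element factor as products of two
    -- off-diagonal ones.
    have e : a * p * b * (1 - p) * c =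
        (p * (a * p * b) * (1 - p)) * ((1 - p) * c * p) + p * (a * p * b * (1 - p) * c) * (1 - p)
        + ((1 - p) * (a * p * b * (1 - p) * c) * p
        + ((1 - p) * a * p) * (p * (b * (1 - p) * c) * (1 - p))) := by
      have e1 : (p * (a * p * b) * (1 - p)) * ((1 - p) * c * p)
          = p * (a * p * b * (1 - p) * c) * p := by
        calc _ = p * (a * p * b) * ((1 - p) * (1 - p)) * c * p := by simp only [mul_assoc]
          _ = _ := by rw [hq]; simp only [mul_assoc]
      have e2 : ((1 - p) * a * p) * (p * (b * (1 - p) * c) * (1 - p))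
          = (1 - p) * (a * p * b * (1 - p) * c) * (1 - p) := by
        calc _ = (1 - p) * a * (p * p) * (b * (1 - p) * c) * (1 - p) := by simp only [mul_assoc]
          _ = _ := by rw [hp]; simp only [mul_assoc]
      rw [e1, e2, ← mul_add, ← mul_add, ← add_mul, add_sub_cancel, mul_one, ← add_mul,
        add_sub_cancel, one_mul]
    rw [e]
    exact (((h1 _).mul_right (h2 _)).add_right (h1 _)).add_right
      ((h2 _).add_right ((h2 _).mul_right (h1 _)))
  | zero => exact Commute.zero_right z
  | add x y _ _ hx hy => exact hx.add_right hy
  | smul t x _ hx => exact hx.smul_right t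

end MixedIdeal

/-! ### Central projections and projections with maximal mixed ideal -/

section ProjectionIdeal

open scoped ComplexOrder

variable {B : Type*} [Ring B] [StarRing B] [Algebra ℂ B] [StarModule ℂ B]

theorem QuantumSet.eq_zero_of_star_mul_self (X : QuantumSet B) {x : B} (h : star x * x = 0) :
    x = 0 := by
  by_contra hx
  have := X.pos x hx
  rw [h, map_zero] at this
  exact lt_irrefl _ this

theorem QuantumSet.eq_zero_of_mul_star_self (X : QuantumSet B) {x : B} (h : x * star x = 0) :
    x = 0 := by
  have h1 : star (star x) * star x = 0 := by rwa [star_star]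
  exact star_eq_zero.mp (X.eq_zero_of_star_mul_self h1)

theorem QuantumSet.eq_zero_of_forall_mul (X : QuantumSet B) {x : B} (h : ∀ y, X.ψ (y * x) = 0) :
    x = 0 := by
  by_contra hx
  have := X.pos x hx
  rw [h] at this
  exact lt_irrefl _ this

theorem QuantumSet.ψ_rotate (X : QuantumSet B) (x y z : B) : X.ψ (x * y * z) = X.ψ (z * x * y) := by
  rw [X.tracial, mul_assoc]

/-- A two-sided ideal of a finite quantum set is generated by a central projection. -/
theorem QuantumSet.exists_central_projection (X : QuantumSet B) (J : Submodule ℂ B)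
    (hl : ∀ b, ∀ x ∈ J, b * x ∈ J) (hr : ∀ b, ∀ x ∈ J, x * b ∈ J) :
    ∃ e ∈ J, IsStarProjection e ∧ (∀ x ∈ J, e * x = x) ∧ ∀ b, e * b = b * e := by
  have := X.finiteDimensional
  let T : J →ₗ[ℂ] Module.Dual ℂ J :=
    LinearMap.mk₂ ℂ (fun x y : J => X.ψ ((x : B) * y)) (by intros; simp [add_mul])
      (by intros; simp) (by intros; simp [mul_add]) (by intros; simp)
  have hT : ∀ x y : J, T x y = X.ψ ((x : B) * y) := fun _ _ => rfl
  have hinj : Function.Injective T := by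
    rw [injective_iff_map_eq_zero]
    intro x hx
    -- The test element lies in `J`, and pairing it with `x` gives the square norm of `x * star x`;
    -- so the trace form is non-degenerate on `J`.
    have h1 : X.ψ ((x : B) * (star (x : B) * x * star (x : B))) = 0 := by
      rw [← hT x ⟨_, hr _ _ (hl (star (x : B)) _ x.2)⟩, hx]
      rfl
    have h2 : (x : B) * star (x : B) = 0 := by
      by_contra hne
      have h3 := X.pos _ hne
      rw [star_mul, star_star] at h3
      have h4 : (x : B) * star (x : B) * (x * star (x : B))
        = x * (star (x : B) * x * star (x : B)) := by simp only [mul_assoc]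
      rw [h4, h1] at h3
      exact lt_irrefl _ h3
    exact Subtype.ext (X.eq_zero_of_mul_star_self h2)
  have hsurj : Function.Surjective T :=
    (LinearMap.injective_iff_surjective_of_finrank_eq_finrank
      Subspace.dual_finrank_eq.symm).mp hinj
  -- The element representing `ψ` on `J` is the unit of `J`, by non-degeneracy of `ψ`.
  obtain ⟨e, he⟩ := hsurj (X.ψ ∘ₗ J.subtype)
  have key : ∀ y ∈ J, X.ψ ((e : B) * y) = X.ψ y := by
    intro y hy
    rw [← hT e ⟨y, hy⟩, he]
    rfl
  have hle : ∀ x ∈ J, (e : B) * x = x := by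
    intro x hx
    rw [← sub_eq_zero]
    refine X.eq_zero_of_forall_mul fun b => ?_
    rw [mul_sub, map_sub, sub_eq_zero, X.tracial, X.tracial b x, mul_assoc, key _ (hr _ _ hx)]
  have hre : ∀ x ∈ J, x * (e : B) = x := by
    intro x hx
    rw [← sub_eq_zero]
    refine X.eq_zero_of_forall_mul fun b => ?_
    rw [mul_sub, map_sub, sub_eq_zero, ← mul_assoc, X.tracial, key _ (hl _ _ hx)]
  have hc : ∀ b, (e : B) * b = b * e := fun b => by
    rw [← hre _ (hr b _ e.2), mul_assoc, hle _ (hl b _ e.2)]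
  have hidem : (e : B) * e = e := hle _ e.2
  have hidem' : star (e : B) * star (e : B) = star (e : B) := by rw [← star_mul, hidem]
  -- Once `e = e * star e`, self-adjointness is immediate.
  have hz : (e : B) - e * star (e : B) = 0 := by
    apply X.eq_zero_of_mul_star_self
    rw [star_sub, star_mul, star_star, mul_sub, sub_mul, sub_mul]
    have h1 : (e : B) * star (e : B) * star (e : B) = e * star (e : B) := by
      rw [mul_assoc, hidem']
    have h2 : (e : B) * (e * star (e : B)) = e * star (e : B) := by
      rw [← mul_assoc, hidem]
    have h3 : (e : B) * star (e : B) * (e * star (e : B)) = e * star (e : B) := by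
      rw [mul_assoc, ← mul_assoc (star (e : B)), ← hc, mul_assoc, hidem', h2]
    rw [h1, h2, h3]
    abel
  have hsa : star (e : B) = e := by
    rw [sub_eq_zero] at hz
    rw [hz, star_mul, star_star]
  exact ⟨e, e.2, ⟨hidem, hsa⟩, hle, hc⟩

/-- If the projection `p` has `B p B (1 - p) B` of maximal dimension, then an element commuting
with all commutators `[b, p]` commutes with every projection. -/
theorem QuantumSet.commute_of_maximal_mixedIdeal (X : QuantumSet B) {p : B}
    (hp : IsStarProjection p)
    (hmax : ∀ q : B, IsStarProjection q →
      Module.finrank ℂ (mixedIdeal q) ≤ Module.finrank ℂ (mixedIdeal p))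
    {z : B} (hz' : ∀ b, Commute z (b * p - p * b))
    {q : B} (hq : IsStarProjection q) : Commute z q := by
  have := X.finiteDimensional
  have hI := commute_mixedIdeal hp.isIdempotentElem hz'
  obtain ⟨e, heI, he, heone, hec⟩ := X.exists_central_projection (mixedIdeal p)
    (mul_mem_mixedIdeal p) (mem_mixedIdeal_mul p)
  have hee : e * e = e := he.isIdempotentElem
  have hes : star e = e := he.isSelfAdjoint
  have hqq : q * q = q := hq.isIdempotentElem
  have hqs : star q = q := hq.isSelfAdjoint
  have hpp : p * p = p := hp.isIdempotentElem
  have hps : star p = p := hp.isSelfAdjoint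
  have hff : (1 - e) * (1 - e) = 1 - e := by
    rw [mul_sub, mul_one, sub_mul, one_mul, hee, sub_self, sub_zero]
  have hef : e * (1 - e) = 0 := by rw [mul_sub, mul_one, hee, sub_self]
  have hfe : (1 - e) * e = 0 := by rw [sub_mul, one_mul, hee, sub_self]
  have hfc : ∀ b, (1 - e) * b = b * (1 - e) := fun b => by
    rw [sub_mul, mul_sub, one_mul, mul_one, hec]
  -- `r` is `p` on the blocks of the ideal and `q` on the others. Its mixed ideal contains that of
  -- `p`, so by maximality it gains nothing from `q`.
  set r : B := e * p + (1 - e) * q with hr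
  have her : e * r = e * p := by
    rw [hr, mul_add, ← mul_assoc, ← mul_assoc, hee, hef, zero_mul, add_zero]
  have hfr : (1 - e) * r = (1 - e) * q := by
    rw [hr, mul_add, ← mul_assoc, ← mul_assoc, hff, hfe, zero_mul, zero_add]
  have hrp : IsStarProjection r := by
    constructor
    · change r * r = r
      conv_lhs => enter [1]; rw [hr]
      rw [add_mul, hec p, hfc q, mul_assoc, mul_assoc, her, hfr, ← mul_assoc, ← mul_assoc, ← hec p,
        ← hfc q, mul_assoc, mul_assoc, hpp, hqq]
    · change star r = r
      rw [hr, star_add, star_mul, star_mul, star_sub, star_one, hes, hps, hqs, ← hec, ← hfc]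
  have hle : mixedIdeal p ≤ mixedIdeal r := by
    refine Submodule.span_le.mpr ?_
    rintro _ ⟨a, b, c, rfl⟩
    have h1 : a * p * b * (1 - p) * c = (e * a) * r * b * (1 - r) * c := by
      have hmid : ∀ x y y' w, e * y = e * y' → e * (x * y * w) = e * (x * y' * w) := by
        intro x y y' w h
        rw [← mul_assoc, ← mul_assoc, hec x, mul_assoc x, h, ← mul_assoc x, ← hec x, mul_assoc e x,
          mul_assoc e]
      rw [← heone _ (mem_mixedIdeal p a b c)]
      have h2 : e * (1 - p) = e * (1 - r) := by rw [mul_sub, mul_sub, her]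
      have h3 := hmid a p r (b * (1 - p) * c) her.symm
      have h4 := hmid (a * r * b) (1 - p) (1 - r) c h2
      simp only [mul_assoc] at h3 h4 ⊢
      rw [h3, h4]
    rw [SetLike.mem_coe, h1]
    exact mem_mixedIdeal _ _ _ _
  have heq : mixedIdeal p = mixedIdeal r :=
    Submodule.eq_of_le_of_finrank_le hle (hmax r hrp)
  -- Hence `q` is central off `e`; on `e`, `z` commutes with the whole ideal.
  have hvan : ∀ b, (1 - e) * q * b * (1 - q) = 0 := by
    intro b
    have h1 : (1 - e) * (r * b * (1 - r)) = (1 - e) * q * b * (1 - q) := by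
      have h2 : (1 - e) * (1 - r) = (1 - e) * (1 - q) := by rw [mul_sub, mul_sub, hfr]
      calc (1 - e) * (r * b * (1 - r)) = (1 - e) * (1 - e) * (r * b * (1 - r)) := by rw [hff]
        _ = (1 - e) * ((1 - e) * r * b) * (1 - r) := by simp only [mul_assoc]
        _ = (1 - e) * q * b * ((1 - e) * (1 - r)) := by rw [hfc, hfr]; simp only [mul_assoc]
        _ = (1 - e) * ((1 - e) * q * b) * (1 - q) := by
          rw [h2, ← mul_assoc, ← hfc ((1 - e) * q * b)]
        _ = (1 - e) * (1 - e) * q * b * (1 - q) := by simp only [mul_assoc]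
        _ = _ := by rw [hff]
    apply X.eq_zero_of_mul_star_self
    have hmem : r * b * (1 - r) * star (r * b * (1 - r)) ∈ mixedIdeal p := by
      rw [heq]
      have := mem_mixedIdeal r 1 b (star (r * b * (1 - r)))
      rwa [one_mul] at this
    rw [← h1, star_mul, ← mul_assoc, mul_assoc (1 - e) (r * b * (1 - r))]
    rw [sub_mul 1 e, one_mul, heone _ hmem, sub_self, zero_mul]
  have hvan' : ∀ b, (1 - e) * (1 - q) * b * q = 0 := by
    intro b
    have h := congrArg star (hvan (star b))
    simp only [star_mul, star_sub, star_one, star_star, hes, hqs, star_zero] at h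
    rw [mul_assoc (1 - e), mul_assoc (1 - e), hfc]
    simpa only [mul_assoc] using h
  have hf : (1 - e) * (z * q) = (1 - e) * (q * z) := by
    have h1 := hvan z
    have h2 := hvan' z
    rw [mul_sub, mul_one, sub_eq_zero] at h1
    rw [mul_sub, mul_one, sub_mul, sub_mul, sub_eq_zero] at h2
    rw [← mul_assoc, ← mul_assoc]
    exact h2.trans h1.symm
  have he' : e * (z * q) = e * (q * z) := by
    have h1 : Commute z (e * q) := hI _ (mem_mixedIdeal_mul p q e heI)
    rw [← mul_assoc, hec z, mul_assoc, h1.eq, mul_assoc]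
  change z * q = q * z
  have h := congrArg₂ (· + ·) he' hf
  simpa only [← add_mul, add_sub_cancel, one_mul] using h

end ProjectionIdeal

/-! ### Unitaries with two eigenvalues -/

section Phase

variable {B : Type*} [Ring B] [Algebra ℂ B]

/-- The unitary with eigenvalue `w` on the projection `r` and `1` on its complement. -/
def phase (r : B) (w : ℂ) : B := (1 - r) + w • r

theorem phase_one (r : B) : phase r 1 = 1 := by simp [phase]

variable [StarRing B]

theorem phase_mul_phase {r : B} (hr : IsStarProjection r) (w w' : ℂ) :
    phase r w * phase r w' = phase r (w * w') := by
  have hrr : r * r = r := hr.isIdempotentElem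
  simp only [phase, mul_add, add_mul, mul_sub, sub_mul, mul_one, one_mul, mul_smul_comm,
    smul_mul_assoc, hrr, smul_smul, sub_self, zero_add]
  rw [mul_comm w' w]
  abel

end Phase

/-! ### Rotated projections and the genericity argument -/

section Perturbation

variable {B : Type*} [Ring B] [StarRing B] [Algebra ℂ B] [StarModule ℂ B]

theorem infinite_setOf_norm_eq_one : {w : ℂ | ‖w‖ = 1}.Infinite := by
  have h : Set.InjOn (fun t : ℝ => Complex.exp (t * Complex.I)) (Set.Ioc (-Real.pi) Real.pi) := by
    intro s hs t ht hst
    have h1 := Complex.arg_exp_mul_I s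
    have h2 := Complex.arg_exp_mul_I t
    rw [show Complex.exp (s * Complex.I) = Complex.exp (t * Complex.I) from hst, h2] at h1
    have hs' : toIocMod Real.two_pi_pos (-Real.pi) s = s :=
      (toIocMod_eq_self Real.two_pi_pos).mpr ⟨hs.1, by linarith [hs.2]⟩
    have ht' : toIocMod Real.two_pi_pos (-Real.pi) t = t :=
      (toIocMod_eq_self Real.two_pi_pos).mpr ⟨ht.1, by linarith [ht.2]⟩
    rw [hs', ht'] at h1
    exact h1.symm
  have h2 := (Set.Ioc_infinite (show -Real.pi < Real.pi by linarith [Real.pi_pos])).image h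
  refine h2.mono ?_
  rintro _ ⟨t, -, rfl⟩
  exact Complex.norm_exp_ofReal_mul_I t

theorem star_phase {r : B} (hr : IsStarProjection r) (w : ℂ) :
    star (phase r w) = phase r (star w) := by
  have hrs : star r = r := hr.isSelfAdjoint
  simp [phase, hrs]

/-- The conjugate of `p` by the unitary `phase r w`. -/
def rotate (r p : B) (w : ℂ) : B := phase r w * p * star (phase r w)

theorem star_mul_self_eq_one {w : ℂ} (hw : ‖w‖ = 1) : star w * w = 1 := by
  rw [Complex.star_def, Complex.conj_mul', hw]
  norm_num

theorem star_phase_mul_phase {r : B} (hr : IsStarProjection r) {w : ℂ} (hw : ‖w‖ = 1) :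
    star (phase r w) * phase r w = 1 := by
  rw [star_phase hr, phase_mul_phase hr, star_mul_self_eq_one hw, phase_one]

theorem isStarProjection_rotate {r p : B} (hr : IsStarProjection r) (hp : IsStarProjection p)
    {w : ℂ} (hw : ‖w‖ = 1) : IsStarProjection (rotate r p w) := by
  have hpp : p * p = p := hp.isIdempotentElem
  have hps : star p = p := hp.isSelfAdjoint
  constructor
  · change rotate r p w * rotate r p w = _
    calc _ = phase r w * p * (star (phase r w) * phase r w) * p * star (phase r w) := by
          simp only [rotate, mul_assoc]
      _ = _ := by rw [star_phase_mul_phase hr hw, mul_one, mul_assoc _ p p, hpp, rotate]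
  · change star (rotate r p w) = _
    simp only [rotate, star_mul, star_star, hps, mul_assoc]

/-- The polynomial with value `w * φ (rotate r p w)` at `w` of modulus one. -/
noncomputable def rotatePolynomial (r p : B) (φ : B →ₗ[ℂ] ℂ) : Polynomial ℂ :=
  Polynomial.C (φ (r * p * (1 - r))) * Polynomial.X ^ 2
    + Polynomial.C (φ (r * p * r + (1 - r) * p * (1 - r))) * Polynomial.X
    + Polynomial.C (φ ((1 - r) * p * r))

/-- On the unit circle `star w` is `w⁻¹`, and the factor `w` clears this single negative power. -/
theorem eval_rotatePolynomial {r : B} (hr : IsStarProjection r) (p : B) (φ : B →ₗ[ℂ] ℂ) {w : ℂ}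
    (hw : ‖w‖ = 1) : (rotatePolynomial r p φ).eval w = w * φ (rotate r p w) := by
  have h1 := star_mul_self_eq_one hw
  have h2 : rotate r p w = w • (r * p * (1 - r)) + (w * star w) • (r * p * r)
      + (1 - r) * p * (1 - r) + star w • ((1 - r) * p * r) := by
    rw [rotate, star_phase hr, phase, phase]
    simp only [add_mul, mul_add, smul_add, smul_mul_assoc, mul_smul_comm, smul_smul, mul_comm (star w) w]
    abel
  rw [h2]
  simp only [rotatePolynomial, Polynomial.eval_add, Polynomial.eval_mul, Polynomial.eval_C,
    Polynomial.eval_X, Polynomial.eval_pow, map_add, map_smul, smul_eq_mul]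
  linear_combination (-(w * φ (r * p * r)) - φ ((1 - r) * p * r)) * h1

theorem rotatePolynomial_ne_zero {r : B} (hr : IsStarProjection r) {p : B} {φ : B →ₗ[ℂ] ℂ}
    (h : φ p ≠ 0) : rotatePolynomial r p φ ≠ 0 := by
  intro h0
  have h1 := eval_rotatePolynomial hr p φ (w := 1) (by simp)
  rw [h0, Polynomial.eval_zero, one_mul, rotate, phase_one, star_one, one_mul, mul_one] at h1
  exact h h1.symm

/-- A polynomial with infinitely many roots is zero; its extreme coefficients are the values of `φ`
on the off-diagonal corners. -/
theorem map_mul_one_sub_eq_zero {r : B} (hr : IsStarProjection r) {p : B} {φ : B →ₗ[ℂ] ℂ}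
    {s : Set ℂ} (hs : s.Infinite) (hs1 : ∀ w ∈ s, ‖w‖ = 1) (h : ∀ w ∈ s, φ (rotate r p w) = 0) :
    φ (r * p * (1 - r)) = 0 ∧ φ ((1 - r) * p * r) = 0 := by
  have h0 : rotatePolynomial r p φ = 0 := by
    refine Polynomial.eq_zero_of_infinite_isRoot _ (hs.mono fun w hw => ?_)
    change Polynomial.eval _ _ = 0
    rw [eval_rotatePolynomial hr p φ (hs1 w hw), h w hw, mul_zero]
  constructor
  · have := congrArg (fun q => Polynomial.coeff q 2) h0
    simpa [rotatePolynomial, Polynomial.coeff_X, Polynomial.coeff_C] using this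
  · have := congrArg (fun q => Polynomial.coeff q 0) h0
    simpa [rotatePolynomial, Polynomial.coeff_X, Polynomial.coeff_C] using this

/-- In a finite quantum set spanned by projections, for finitely many elements `z` none of which
commutes with all projections there is a projection `p` with `ψ (p z) ≠ 0` for all of them. -/
theorem QuantumSet.exists_projection_forall_ne_zero (X : QuantumSet B)
    (hspan : Submodule.span ℂ {q : B | IsStarProjection q} = ⊤) (Z : Finset B)
    (hZ : ∀ z ∈ Z, ∃ b, ¬ Commute z b) :
    ∃ p : B, IsStarProjection p ∧ ∀ z ∈ Z, X.ψ (p * z) ≠ 0 := by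
  classical
  have := X.finiteDimensional
  let M : B → Prop := fun p => IsStarProjection p ∧ ∀ q : B, IsStarProjection q →
      Module.finrank ℂ (mixedIdeal q) ≤ Module.finrank ℂ (mixedIdeal p)
  have hM0 : ∃ p, M p := by
    let s : Set ℕ := (fun q : B => Module.finrank ℂ (mixedIdeal q)) '' {q | IsStarProjection q}
    have hs : BddAbove s :=
      ⟨Module.finrank ℂ B, by rintro _ ⟨q, -, rfl⟩; exact Submodule.finrank_le _⟩
    obtain ⟨p, hp, hps⟩ := Nat.sSup_mem (s := s) ⟨_, 0, IsStarProjection.zero B, rfl⟩ hs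
    exact ⟨p, hp, fun q hq => (le_csSup hs ⟨q, hq, rfl⟩).trans hps.ge⟩
  have hMrot : ∀ p, M p → ∀ r, IsStarProjection r → ∀ w : ℂ, ‖w‖ = 1 → M (rotate r p w) := by
    intro p hp r hr w hw
    refine ⟨isStarProjection_rotate hr hp.1 hw, fun q hq => (hp.2 q hq).trans ?_⟩
    exact Submodule.finrank_mono
      (mixedIdeal_le_conj (star_phase_mul_phase hr hw))
  suffices h : ∃ p, M p ∧ ∀ z ∈ Z, X.ψ (p * z) ≠ 0 by
    obtain ⟨p, hp, h⟩ := h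
    exact ⟨p, hp.1, h⟩
  induction Z using Finset.induction_on with
  | empty =>
    obtain ⟨p, hp⟩ := hM0
    exact ⟨p, hp, by simp⟩
  | insert z₀ Z _ ih =>
    obtain ⟨p, hpM, hpZ⟩ := ih fun z hz => hZ z (Finset.mem_insert_of_mem hz)
    by_contra! hcon
    have hbad : ∀ p, M p → (∀ z ∈ Z, X.ψ (p * z) ≠ 0) → X.ψ (p * z₀) = 0 := by
      intro p hp hpZ
      obtain ⟨z, hz, hz0⟩ := hcon p hp
      rcases Finset.mem_insert.mp hz with rfl | hz
      · exact hz0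
      · exact absurd hz0 (hpZ z hz)
    -- Being good for `Z` excludes only the roots of one non-zero polynomial, so infinitely many
    -- rotations stay good.
    have hrot : ∀ p, M p → (∀ z ∈ Z, X.ψ (p * z) ≠ 0) → ∀ r, IsStarProjection r →
        ∃ s : Set ℂ, s.Infinite ∧ (∀ w ∈ s, ‖w‖ = 1) ∧
          ∀ w ∈ s, M (rotate r p w) ∧ ∀ z ∈ Z, X.ψ (rotate r p w * z) ≠ 0 := by
      intro p hp hpZ r hr
      let φ : B → B →ₗ[ℂ] ℂ := fun z => X.ψ ∘ₗ LinearMap.mulRight ℂ z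
      have hne : ∏ z ∈ Z, rotatePolynomial r p (φ z) ≠ 0 :=
        Finset.prod_ne_zero_iff.mpr fun z hz => rotatePolynomial_ne_zero hr (hpZ z hz)
      refine ⟨_, infinite_setOf_norm_eq_one.sdiff (Polynomial.finite_setOfPred_isRoot hne),
        fun w hw => hw.1, fun w hw => ⟨hMrot p hp r hr w hw.1, fun z hz h0 => hw.2 ?_⟩⟩
      change Polynomial.eval _ _ = 0
      rw [Polynomial.eval_prod]
      refine Finset.prod_eq_zero hz ?_
      rw [eval_rotatePolynomial hr p _ hw.1]
      change w * X.ψ (rotate r p w * z) = 0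
      rw [h0, mul_zero]
    -- First use of the rotations: the two corner identities subtract to `ψ (r * [p, z₀]) = 0` for
    -- every projection `r`, and projections span.
    have hcomm : ∀ p, M p → (∀ z ∈ Z, X.ψ (p * z) ≠ 0) → p * z₀ - z₀ * p = 0 := by
      intro p hp hpZ
      refine X.eq_zero_of_forall_mul fun y => ?_
      have hy : y ∈ Submodule.span ℂ {q : B | IsStarProjection q} := hspan ▸ Submodule.mem_top
      induction hy using Submodule.span_induction with
      | mem r hr =>
        obtain ⟨s, hs, hs1, hsM⟩ := hrot p hp hpZ r hr
        obtain ⟨h1, h2⟩ := map_mul_one_sub_eq_zero (φ := X.ψ ∘ₗ LinearMap.mulRight ℂ z₀) hr hs hs1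
          fun w hw => hbad _ (hsM w hw).1 (hsM w hw).2
        change X.ψ (r * p * (1 - r) * z₀) = 0 at h1
        change X.ψ ((1 - r) * p * r * z₀) = 0 at h2
        have h3 : X.ψ (r * (z₀ * p)) = X.ψ (p * r * z₀) := by
          rw [← mul_assoc, X.ψ_rotate]
        have h4 : r * (p * z₀) - p * r * z₀ = r * p * (1 - r) * z₀ - (1 - r) * p * r * z₀ := by
          noncomm_ring
        rw [mul_sub, map_sub, h3, ← map_sub, h4, map_sub, h1, h2, sub_zero]
      | zero => simp
      | add x y _ _ hx hy => rw [add_mul, map_add, hx, hy, add_zero]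
      | smul t x _ hx => rw [smul_mul_assoc, map_smul, hx, smul_zero]
    -- Second use: the rotated projections commute with `z₀` too, hence so do both corners of `p`
    -- relative to `r`, whose difference is `[r, p]`.
    have hcomm' : ∀ b, (b * p - p * b) * z₀ - z₀ * (b * p - p * b) = 0 := by
      intro y
      have hy : y ∈ Submodule.span ℂ {q : B | IsStarProjection q} := hspan ▸ Submodule.mem_top
      induction hy using Submodule.span_induction with
      | mem r hr =>
        obtain ⟨s, hs, hs1, hsM⟩ := hrot p hpM hpZ r hr
        have hφ : ∀ y : B, X.ψ (y * ((r * p * (1 - r)) * z₀ - z₀ * (r * p * (1 - r)))) = 0 ∧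
            X.ψ (y * (((1 - r) * p * r) * z₀ - z₀ * ((1 - r) * p * r))) = 0 := fun y =>
          map_mul_one_sub_eq_zero (φ := X.ψ ∘ₗ LinearMap.mulLeft ℂ y ∘ₗ
              (LinearMap.mulRight ℂ z₀ - LinearMap.mulLeft ℂ z₀)) hr hs hs1 fun w hw => by
            change X.ψ (y * (rotate r p w * z₀ - z₀ * rotate r p w)) = 0
            rw [hcomm _ (hsM w hw).1 (hsM w hw).2, mul_zero, map_zero]
        have h1 := X.eq_zero_of_forall_mul fun y => (hφ y).1
        have h2 := X.eq_zero_of_forall_mul fun y => (hφ y).2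
        have h3 : (r * p - p * r) * z₀ - z₀ * (r * p - p * r)
            = ((r * p * (1 - r)) * z₀ - z₀ * (r * p * (1 - r)))
              - (((1 - r) * p * r) * z₀ - z₀ * ((1 - r) * p * r)) := by
          noncomm_ring
        rw [h3, h1, h2, sub_zero]
      | zero => simp
      | add x y _ _ hx hy =>
        rw [← add_zero (0 : B)]
        nth_rewrite 1 [← hx]
        rw [← hy]
        noncomm_ring
      | smul t x _ hx =>
        rw [← smul_zero t, ← hx]
        simp only [smul_mul_assoc, mul_smul_comm, smul_sub, sub_mul, mul_sub]
    obtain ⟨b, hb⟩ := hZ z₀ (Finset.mem_insert_self _ _)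
    apply hb
    have hy : b ∈ Submodule.span ℂ {q : B | IsStarProjection q} := hspan ▸ Submodule.mem_top
    induction hy using Submodule.span_induction with
    | mem q hq =>
      exact X.commute_of_maximal_mixedIdeal hpM.1 hpM.2
        (fun b => (sub_eq_zero.mp (hcomm' b)).symm) hq
    | zero => exact Commute.zero_right _
    -- The induction generalises `hb`, so each induction hypothesis assumes non-commutation; a case
    -- split discharges it.
    | add x y _ _ hx hy =>
      by_cases h1 : Commute z₀ x
      · by_cases h2 : Commute z₀ y
        · exact h1.add_right h2
        · exact absurd (hy h2) h2
      · exact absurd (hx h1) h1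
    | smul t x _ hx =>
      by_cases h1 : Commute z₀ x
      · exact h1.smul_right t
      · exact absurd (hx h1) h1

end Perturbation

/-! ### Unitaries of finite order as combinations of projections -/

section SpectralProjections

variable {B : Type*} [Ring B] [StarRing B] [Algebra ℂ B] [StarModule ℂ B]

/-- The average of the powers is the spectral projection of `x` for the eigenvalue `1`: the sum `S`
absorbs `x` and `star x`, so `star S * S = n • S`. -/
theorem isStarProjection_average {x : B} {n : ℕ} (hn : n ≠ 0) (hx : star x * x = 1)
    (hxn : x ^ n = 1) :
    IsStarProjection ((n : ℂ)⁻¹ • ∑ k ∈ Finset.range n, x ^ k) := by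
  set S : B := ∑ k ∈ Finset.range n, x ^ k with hS
  have hn' : (n : ℂ) ≠ 0 := by exact_mod_cast hn
  have h1 : x * S = S := by
    have := mul_geom_sum x n
    rwa [hxn, sub_self, sub_mul, one_mul, sub_eq_zero] at this
  have h2 : star x * S = S := by
    conv_lhs => rw [← h1, ← mul_assoc, hx, one_mul]
  have h3 : ∀ k : ℕ, star (x ^ k) * S = S := by
    intro k
    induction k with
    | zero => simp
    | succ k ih => rw [pow_succ', star_mul, mul_assoc, h2, ih]
  have h4 : star S * S = (n : ℂ) • S := by
    conv_lhs => enter [1]; rw [hS, star_sum]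
    rw [Finset.sum_mul, Finset.sum_congr rfl fun k _ => h3 k, Finset.sum_const, Finset.card_range,
      Nat.cast_smul_eq_nsmul]
  have h5 : star ((n : ℂ)⁻¹ • S) * ((n : ℂ)⁻¹ • S) = (n : ℂ)⁻¹ • S := by
    rw [star_smul, smul_mul_smul_comm, h4, smul_smul]
    congr 1
    simp [hn']
  have h6 : star ((n : ℂ)⁻¹ • S) = (n : ℂ)⁻¹ • S := by
    conv_lhs => rw [← h5, star_mul, star_star, h5]
  refine ⟨?_, h6⟩
  rw [h6] at h5
  exact h5

/-- A unitary of finite order is a linear combination of projections. -/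
theorem mem_span_isStarProjection {x : B} {n : ℕ} (hn : n ≠ 0) (hx : star x * x = 1)
    (hxn : x ^ n = 1) : x ∈ Submodule.span ℂ {q : B | IsStarProjection q} := by
  have hn' : (n : ℂ) ≠ 0 := by exact_mod_cast hn
  obtain ⟨ζ, hζ⟩ : ∃ ζ : ℂ, IsPrimitiveRoot ζ n := ⟨_, Complex.isPrimitiveRoot_exp n hn⟩
  have hζ1 : star ζ * ζ = 1 := star_mul_self_eq_one (hζ.norm'_eq_one hn)
  have hy : ∀ j : ℕ, star (ζ ^ j • x) * (ζ ^ j • x) = 1 := by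
    intro j
    rw [star_smul, smul_mul_smul_comm, hx, star_pow, ← mul_pow, hζ1, one_pow, one_smul]
  have hyn : ∀ j : ℕ, (ζ ^ j • x) ^ n = 1 := by
    intro j
    rw [smul_pow, hxn, ← pow_mul, mul_comm, pow_mul, hζ.pow_eq_one, one_pow, one_smul]
  -- Spectral decomposition: the average for `ζ ^ j • x` projects onto the eigenvalue `ζ ^ (-j) = ζ
  -- ^ (j * (n - 1))` of `x`.
  have hsum : ∑ j ∈ Finset.range n, ζ ^ (j * (n - 1)) •
      ((n : ℂ)⁻¹ • ∑ k ∈ Finset.range n, (ζ ^ j • x) ^ k) = x := by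
    -- The cyclic shift makes `k = 0`, the only index surviving orthogonality of roots of unity,
    -- contribute `x` itself.
    have h1 : ∀ j : ℕ, ∑ k ∈ Finset.range n, (ζ ^ j • x) ^ k
        = ∑ k ∈ Finset.range n, (ζ ^ j • x) ^ (k + 1) := by
      intro j
      have := mul_geom_sum (ζ ^ j • x) n
      rw [hyn, sub_self, sub_mul, one_mul, sub_eq_zero] at this
      rw [← this, Finset.mul_sum]
      simp only [pow_succ']
    have h2 : ∀ j k : ℕ, ζ ^ (j * (n - 1)) • (ζ ^ j • x) ^ (k + 1) = (ζ ^ k) ^ j • x ^ (k + 1) := by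
      intro j k
      rw [smul_pow, smul_smul, ← pow_mul, ← pow_mul, ← pow_add]
      have h3 : j * (n - 1) + j * (k + 1) = n * j + k * j := by
        obtain ⟨m, rfl⟩ := Nat.exists_eq_succ_of_ne_zero hn
        simp only [Nat.succ_eq_add_one, Nat.add_sub_cancel]
        ring
      rw [h3, pow_add, pow_mul, hζ.pow_eq_one, one_pow, one_mul]
    calc _ = (n : ℂ)⁻¹ • ∑ k ∈ Finset.range n, (∑ j ∈ Finset.range n, (ζ ^ k) ^ j) • x ^ (k + 1) := by
          simp only [h1, smul_comm _ (n : ℂ)⁻¹, ← Finset.smul_sum]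
          congr 1
          simp only [Finset.smul_sum, h2, Finset.sum_smul]
          exact Finset.sum_comm
      _ = (n : ℂ)⁻¹ • (∑ j ∈ Finset.range n, (ζ ^ 0) ^ j) • x ^ (0 + 1) := by
          congr 1
          refine Finset.sum_eq_single 0 (fun k hk hk0 => ?_) (fun h => absurd
            (Finset.mem_range.mpr (Nat.pos_of_ne_zero hn)) h)
          have h4 := mul_geom_sum (ζ ^ k) n
          rw [← pow_mul, mul_comm k, pow_mul, hζ.pow_eq_one, one_pow, sub_self, mul_eq_zero,
            sub_eq_zero] at h4
          rw [h4.resolve_left (hζ.pow_ne_one_of_pos_of_lt hk0 (Finset.mem_range.mp hk)), zero_smul]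
      _ = x := by simp [smul_smul, hn']
  rw [← hsum]
  exact Submodule.sum_mem _ fun j _ => Submodule.smul_mem _ _
    (Submodule.subset_span (isStarProjection_average hn (hy j) (hyn j)))

end SpectralProjections

/-! ### Separating projections and their Cayley graphs on the dual of a group -/

section GroupAlgebra

variable {Γ : Type*} [Group Γ]

theorem span_isStarProjection_groupAlgebra [Finite Γ] :
    Submodule.span ℂ {q : MonoidAlgebra ℂ Γ | IsStarProjection q} = ⊤ := by
  rw [eq_top_iff, ← (MonoidAlgebra.basis Γ ℂ).span_eq, Submodule.span_le]
  rintro _ ⟨g, rfl⟩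
  rw [MonoidAlgebra.basis_apply]
  refine mem_span_isStarProjection (orderOf_pos g).ne' ?_ ?_
  · simp [groupAlgebra_star_single, MonoidAlgebra.single_mul_single, MonoidAlgebra.one_def]
  · simp [MonoidAlgebra.single_pow, pow_orderOf_eq_one, MonoidAlgebra.one_def]

theorem not_commute_single_sub_single {g h x : Γ} (hx : ¬ Commute g x) (hne : h ≠ g) :
    ¬ Commute (MonoidAlgebra.single g (1 : ℂ) - MonoidAlgebra.single h 1)
      (MonoidAlgebra.single x 1) := by
  classical
  intro hc
  -- At `g * x` the left product has coefficient `1`, the right one `0` or `-1`.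
  have h1 := congrArg (fun y => MonoidAlgebra.coeff y (g * x)) hc.eq
  simp only [sub_mul, mul_sub, MonoidAlgebra.single_mul_single, mul_one, MonoidAlgebra.coeff_sub,
    MonoidAlgebra.coeff_single, Finsupp.sub_apply, Finsupp.single_apply, if_true,
    mul_left_inj, if_neg hne] at h1
  rw [if_neg fun e => hx e.symm] at h1
  split_ifs at h1 <;> norm_num at h1

variable [Fintype Γ]

/-- There is a projection in `ℂ[Γ]` whose coefficient at any non-central element of `Γ` differs from
all its other coefficients. -/
theorem exists_projection_separating (Γ : Type*) [Group Γ] [Fintype Γ] :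
    ∃ p : MonoidAlgebra ℂ Γ, IsStarProjection p ∧
      ∀ g h x : Γ, ¬ Commute g x → h ≠ g → p.coeff h ≠ p.coeff g := by
  classical
  -- Inverses appear because `ψ (p * g⁻¹)` is `|Γ|` times the coefficient of `p` at `g`.
  let Z : Finset (MonoidAlgebra ℂ Γ) :=
    ((Finset.univ : Finset (Γ × Γ)).filter fun t => (∃ x, ¬ Commute t.1 x) ∧ t.2 ≠ t.1).image
      fun t => MonoidAlgebra.single t.1⁻¹ (1 : ℂ) - MonoidAlgebra.single t.2⁻¹ 1
  obtain ⟨p, hp, h⟩ := (dualQuantumSet Γ).exists_projection_forall_ne_zero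
    span_isStarProjection_groupAlgebra Z (by
      intro z hz
      obtain ⟨⟨g, h⟩, ht, rfl⟩ := Finset.mem_image.mp hz
      obtain ⟨-, ⟨x, hx⟩, hne⟩ := Finset.mem_filter.mp ht
      exact ⟨_, not_commute_single_sub_single (x := x)
        (fun hc => hx (Commute.inv_left_iff.mp hc)) fun e => hne (inv_injective e)⟩)
  refine ⟨p, hp, fun g k x hx hne he => ?_⟩
  refine h _ (Finset.mem_image.mpr
    ⟨(g, k), Finset.mem_filter.mpr ⟨Finset.mem_univ _, ⟨x, hx⟩, hne⟩, rfl⟩) ?_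
  change dualHaar Γ _ = 0
  rw [dualHaar_apply, mul_sub, MonoidAlgebra.coeff_sub, Finsupp.sub_apply,
    MonoidAlgebra.coeff_mul_single_apply, MonoidAlgebra.coeff_mul_single_apply]
  simp [he]

theorem dualHaar_antipode_mul_single (p : MonoidAlgebra ℂ Γ) (g : Γ) :
    dualHaar Γ (HopfAlgebra.antipode ℂ p * MonoidAlgebra.single g 1)
      = Fintype.card Γ * p.coeff g := by
  classical
  induction p using MonoidAlgebra.induction_linear with
  | zero => simp
  | add x y hx hy => simp [add_mul, mul_add, hx, hy]
  | single h c =>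
    simp [MonoidAlgebra.antipode_single, MonoidAlgebra.single_mul_single, dualHaar_single,
      Finsupp.single_apply, inv_mul_eq_one]

/-- Since `Δ g = g ⊗ g`, convolution is diagonal in the basis `Γ`; the antipode makes the eigenvalue
at `g` the coefficient at `g` rather than at `g⁻¹`. -/
theorem convolution_single (p : MonoidAlgebra ℂ Γ) (g : Γ) (c : ℂ) :
    (dualQuantumSet Γ).convolution p (MonoidAlgebra.single g c)
      = (Fintype.card Γ * p.coeff g) • MonoidAlgebra.single g c := by
  have h : MonoidAlgebra.single g c = c • MonoidAlgebra.single g (1 : ℂ) := by simp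
  rw [h, map_smul, smul_comm]
  congr 1
  rw [← dualHaar_antipode_mul_single]
  simp [QuantumSet.convolution, leftConv, QuantumSet.density, dualQuantumSet]

/-- The quantum Cayley graph of a projection on the dual of a finite group. -/
noncomputable def dualCayleyGraph (p : MonoidAlgebra ℂ Γ) (hp : IsStarProjection p) :
    QuantumGraph (dualQuantumSet Γ) where
  A := (dualQuantumSet Γ).convolution p
  schur_idempotent := by
    classical
    have hcard : (Fintype.card Γ : ℂ) ≠ 0 := by exact_mod_cast Fintype.card_ne_zero
    refine (MonoidAlgebra.basis Γ ℂ).ext fun g => ?_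
    rw [MonoidAlgebra.basis_apply]
    change LinearMap.mul' ℂ _ (TensorProduct.map _ _ (dualMulAdj Γ (MonoidAlgebra.single g 1))) = _
    have hpp : ∑ h : Γ, p.coeff h * p.coeff (h⁻¹ * g) = p.coeff g := by
      conv_rhs => rw [← (hp.isIdempotentElem : p * p = p)]
      rw [MonoidAlgebra.coeff_mul_apply_left, Finsupp.sum_fintype _ _ (by simp)]
    simp only [dualMulAdj_single, map_smul, map_sum, TensorProduct.map_tmul,
      convolution_single, LinearMap.mul'_apply, smul_mul_smul_comm,
      MonoidAlgebra.single_mul_single, mul_inv_cancel_left, mul_one, ← Finset.sum_smul, smul_smul]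
    congr 1
    rw [← hpp, Finset.mul_sum, Finset.mul_sum]
    refine Finset.sum_congr rfl fun h _ => ?_
    field_simp
  real := by
    intro f
    have hps : ∀ g, star (p.coeff g⁻¹) = p.coeff g := fun g => by
      rw [← groupAlgebra_coeff_star, (hp.isSelfAdjoint : star p = p)]
    induction f using MonoidAlgebra.induction_linear with
    | zero => simp
    | add x y hx hy => simp only [star_add, map_add, hx, hy]
    | single g c =>
      rw [groupAlgebra_star_single, convolution_single, convolution_single, star_smul,
        groupAlgebra_star_single, inv_inv, star_star, star_mul', hps]
      simp

theorem dualCayleyGraph_single (p : MonoidAlgebra ℂ Γ) (hp : IsStarProjection p) (g : Γ) (c : ℂ) :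
    (dualCayleyGraph p hp).A (MonoidAlgebra.single g c)
      = (Fintype.card Γ * p.coeff g) • MonoidAlgebra.single g c :=
  convolution_single p g c

end GroupAlgebra

/-! ### Homomorphisms commuting with a separating multiplier -/

section Slices

variable {Γ : Type*} {K : Type*} [Ring K] [Algebra ℂ K]

/-- The `g`-th coefficient of an element of `ℂ[Γ] ⊗ K`. -/
noncomputable def tensorCoeff (g : Γ) : MonoidAlgebra ℂ Γ ⊗[ℂ] K →ₗ[ℂ] K :=
  (TensorProduct.lid ℂ K).toLinearMap ∘ₗ LinearMap.rTensor K ((MonoidAlgebra.basis Γ ℂ).coord g)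

theorem tensorCoeff_tmul (g : Γ) (x : MonoidAlgebra ℂ Γ) (a : K) :
    tensorCoeff g (x ⊗ₜ[ℂ] a) = x.coeff g • a := by
  simp only [tensorCoeff, LinearMap.comp_apply, LinearMap.rTensor_tmul, LinearEquiv.coe_coe,
    TensorProduct.lid_tmul]
  rfl

theorem tensorCoeff_single_tmul (g : Γ) (a : K) :
    tensorCoeff g (MonoidAlgebra.single g (1 : ℂ) ⊗ₜ[ℂ] a) = a := by
  simp [tensorCoeff_tmul]

theorem single_tmul_injective (g : Γ) {a b : K}
    (h : MonoidAlgebra.single g (1 : ℂ) ⊗ₜ[ℂ] a = MonoidAlgebra.single g (1 : ℂ) ⊗ₜ[ℂ] b) :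
    a = b := by
  rw [← tensorCoeff_single_tmul g a, h, tensorCoeff_single_tmul]

variable [Fintype Γ]

theorem sum_single_tmul_tensorCoeff (t : MonoidAlgebra ℂ Γ ⊗[ℂ] K) :
    ∑ g : Γ, MonoidAlgebra.single g (1 : ℂ) ⊗ₜ[ℂ] tensorCoeff g t = t := by
  classical
  induction t using TensorProduct.induction_on with
  | zero => simp
  | add x y hx hy => simp only [map_add, TensorProduct.tmul_add, Finset.sum_add_distrib, hx, hy]
  | tmul x a =>
    simp only [tensorCoeff_tmul, ← TensorProduct.smul_tmul, ← TensorProduct.sum_tmul]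
    congr 1
    ext h
    simp

variable [Group Γ]

theorem tensorCoeff_rTensor_dualCayleyGraph (p : MonoidAlgebra ℂ Γ) (hp : IsStarProjection p)
    (h : Γ) (t : MonoidAlgebra ℂ Γ ⊗[ℂ] K) :
    tensorCoeff h (LinearMap.rTensor K (dualCayleyGraph p hp).A t)
      = ((Fintype.card Γ : ℂ) * p.coeff h) • tensorCoeff h t := by
  classical
  conv_lhs => rw [← sum_single_tmul_tensorCoeff t]
  simp only [map_sum, LinearMap.rTensor_tmul, dualCayleyGraph_single, tensorCoeff_tmul]
  rw [Finset.sum_eq_single h]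
  · simp
  · intro g _ hg
    simp [hg]
  · simp

/-- An algebra homomorphism `ℂ[Γ] → ℂ[Γ] ⊗ K` that commutes with a Fourier multiplier separating the
non-central elements of `Γ` multiplies the elements of `Γ` by elements of `K`. -/
theorem exists_eq_single_tmul (hΓ : Group.IsPerfect Γ) {p : MonoidAlgebra ℂ Γ}
    (hp : IsStarProjection p)
    (hsep : ∀ g h x : Γ, ¬ Commute g x → h ≠ g → p.coeff h ≠ p.coeff g)
    (φ : MonoidAlgebra ℂ Γ →ₐ[ℂ] MonoidAlgebra ℂ Γ ⊗[ℂ] K)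
    (hφ : ∀ x, LinearMap.rTensor K (dualCayleyGraph p hp).A (φ x)
      = φ ((dualCayleyGraph p hp).A x)) (g : Γ) :
    ∃ a : K, φ (MonoidAlgebra.single g 1) = MonoidAlgebra.single g 1 ⊗ₜ[ℂ] a := by
  have hcard : (Fintype.card Γ : ℂ) ≠ 0 := by exact_mod_cast Fintype.card_ne_zero
  have hnc : ∀ g x : Γ, ¬ Commute g x →
      ∃ a : K, φ (MonoidAlgebra.single g 1) = MonoidAlgebra.single g 1 ⊗ₜ[ℂ] a := by
    intro g x hx
    set t := φ (MonoidAlgebra.single g 1) with ht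
    refine ⟨tensorCoeff g t, ?_⟩
    conv_lhs => rw [← sum_single_tmul_tensorCoeff t]
    refine Finset.sum_eq_single g (fun h _ hne => ?_) (by simp)
    -- `t` is an eigenvector for the eigenvalue at `g`, so its slice at `h` vanishes when the
    -- eigenvalue at `h` differs.
    have h1 := tensorCoeff_rTensor_dualCayleyGraph p hp h t
    rw [ht, hφ, dualCayleyGraph_single, map_smul, map_smul, ← ht, ← sub_eq_zero, ← sub_smul,
      ← mul_sub, smul_eq_zero] at h1
    rw [h1.resolve_left (mul_ne_zero hcard (sub_ne_zero.mpr (hsep g h x hx hne).symm)),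
      TensorProduct.tmul_zero]
  by_cases hex : ∃ g₀ x : Γ, ¬ Commute g₀ x
  · obtain ⟨g₀, x, hx⟩ := hex
    by_cases hg : ∃ y, ¬ Commute g y
    · obtain ⟨y, hy⟩ := hg
      exact hnc g y hy
    · push Not at hg
      -- A central `g` is the product of the non-central elements `g * g₀` and `g₀⁻¹`.
      have hx' : ¬ Commute (g * g₀) x := by
        intro hc
        have := (hg x).inv_left.mul_left hc
        rw [inv_mul_cancel_left] at this
        exact hx this
      obtain ⟨a, ha⟩ := hnc _ x hx'
      obtain ⟨b, hb⟩ := hnc g₀⁻¹ x fun hc => hx (Commute.inv_left_iff.mp hc)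
      refine ⟨a * b, ?_⟩
      have h1 : MonoidAlgebra.single g (1 : ℂ)
          = MonoidAlgebra.single (g * g₀) 1 * MonoidAlgebra.single g₀⁻¹ 1 := by
        simp [MonoidAlgebra.single_mul_single]
      conv_lhs => rw [h1, map_mul, ha, hb, Algebra.TensorProduct.tmul_mul_tmul, ← h1]
  · push Not at hex
    have hcomm : IsMulCommutative Γ := ⟨⟨fun a b => hex a b⟩⟩
    have hsub : Subsingleton Γ := Group.IsPerfect.subsingleton_of_isMulCommutative
    refine ⟨1, ?_⟩
    rw [Subsingleton.elim g 1, ← MonoidAlgebra.one_def, map_one, Algebra.TensorProduct.one_def]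

end Slices

/-! ### The regular action and its universal property -/

section MainTheorem

variable {Γ : Type*} [Group Γ]

theorem regular_single (g : Γ) (c : ℂ) :
    (QuantumAction.regular (MonoidAlgebra ℂ Γ)).hom (MonoidAlgebra.single g c)
      = MonoidAlgebra.single g (1 : ℂ) ⊗ₜ[ℂ] MonoidAlgebra.single g c := by
  change Coalgebra.comul (R := ℂ) (A := MonoidAlgebra ℂ Γ) _ = _
  have h : MonoidAlgebra.single g c = c • MonoidAlgebra.single g (1 : ℂ) := by simp
  rw [h, map_smul, TensorProduct.tmul_smul]
  simp

theorem isErgodic_regular_groupAlgebra :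
    (QuantumAction.regular (MonoidAlgebra ℂ Γ)).IsErgodic := by
  classical
  refine Set.ext fun x => ⟨?_, ?_⟩
  · intro hx
    change Coalgebra.comul (R := ℂ) x = x ⊗ₜ[ℂ] (1 : MonoidAlgebra ℂ Γ) at hx
    refine ⟨x.coeff 1, ?_⟩
    ext g
    -- For a fixed point the same slice is a multiple of `1`, so the coefficient vanishes unless `g
    -- = 1`.
    have hcomul : ∀ y : MonoidAlgebra ℂ Γ, tensorCoeff g (Coalgebra.comul (R := ℂ) y)
        = MonoidAlgebra.single g (y.coeff g) := by
      intro y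
      induction y using MonoidAlgebra.induction_linear with
      | zero => simp
      | add y z hy hz => simp [hy, hz]
      | single h c =>
        by_cases hh : h = g
        · subst hh
          simp [tensorCoeff_tmul]
        · simp [tensorCoeff_tmul, hh]
    have h1 := hcomul x
    rw [hx, tensorCoeff_tmul, MonoidAlgebra.one_def] at h1
    have h2 := congrArg (fun y => MonoidAlgebra.coeff y g) h1
    by_cases hg : g = 1
    · subst hg
      simp [Algebra.algebraMap_eq_smul_one, MonoidAlgebra.one_def]
    · have hg' : (1 : Γ) ≠ g := fun e => hg e.symm
      simp only [MonoidAlgebra.coeff_smul, Finsupp.smul_apply, MonoidAlgebra.coeff_single,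
        Finsupp.single_eq_same, Finsupp.single_apply, if_neg hg', smul_zero] at h2
      simp [Algebra.algebraMap_eq_smul_one, MonoidAlgebra.one_def, hg', ← h2]
  · rintro ⟨c, rfl⟩
    change Coalgebra.comul (R := ℂ) (algebraMap ℂ (MonoidAlgebra ℂ Γ) c) = _ ⊗ₜ[ℂ] _
    rw [Algebra.algebraMap_eq_smul_one, map_smul, Bialgebra.comul_one, ← TensorProduct.smul_tmul',
      Algebra.TensorProduct.one_def]

theorem isFaithful_regular_groupAlgebra :
    (QuantumAction.regular (MonoidAlgebra ℂ Γ)).IsFaithful := by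
  intro S hS _ _
  have hsingle : ∀ g : Γ, MonoidAlgebra.single g (1 : ℂ) ∈ S := by
    intro g
    have h := hS ((MonoidAlgebra.basis Γ ℂ).coord g) (MonoidAlgebra.single g 1)
    have h1 : (QuantumAction.regular (MonoidAlgebra ℂ Γ)).hom (MonoidAlgebra.single g 1)
        = MonoidAlgebra.single g (1 : ℂ) ⊗ₜ[ℂ] MonoidAlgebra.single g (1 : ℂ) := regular_single g 1
    have h2 := tensorCoeff_single_tmul g (MonoidAlgebra.single g (1 : ℂ))
    rw [← h1] at h2
    rw [← h2]
    exact h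
  rw [eq_top_iff]
  intro x _
  induction x using MonoidAlgebra.induction_linear with
  | zero => exact zero_mem S
  | add x y hx hy => exact add_mem (hx trivial) (hy trivial)
  | single g c =>
    have h : MonoidAlgebra.single g c = c • MonoidAlgebra.single g (1 : ℂ) := by simp
    rw [h]
    exact SMulMemClass.smul_mem c (hsingle g)

variable [Fintype Γ]

theorem isPreservedBy_regular (p : MonoidAlgebra ℂ Γ) (hp : IsStarProjection p) :
    (dualCayleyGraph p hp).IsPreservedBy (QuantumAction.regular (MonoidAlgebra ℂ Γ)) where
  functional x := by
    classical
    induction x using MonoidAlgebra.induction_linear with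
    | zero => simp
    | add x y hx hy => simp only [map_add, hx, hy, add_smul]
    | single g c =>
      rw [regular_single, LinearMap.rTensor_tmul, TensorProduct.lid_tmul]
      change dualHaar Γ _ • _ = dualHaar Γ _ • _
      rw [dualHaar_single, dualHaar_single]
      split_ifs with hg
      · subst hg
        simp [MonoidAlgebra.one_def]
      · simp
  adjacency x := by
    induction x using MonoidAlgebra.induction_linear with
    | zero => simp
    | add x y hx hy => simp only [map_add, hx, hy]
    | single g c =>
      rw [regular_single, LinearMap.rTensor_tmul, dualCayleyGraph_single, dualCayleyGraph_single,
        map_smul, regular_single, TensorProduct.smul_tmul']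

theorem classicalAut_dualCayleyGraph (hΓ : Group.IsPerfect Γ) {p : MonoidAlgebra ℂ Γ}
    (hp : IsStarProjection p)
    (hsep : ∀ g h x : Γ, ¬ Commute g x → h ≠ g → p.coeff h ≠ p.coeff g) :
    (dualCayleyGraph p hp).classicalAut = ⊥ := by
  rw [eq_bot_iff]
  intro θ hθ
  change ∀ x, θ ((dualCayleyGraph p hp).A x) = (dualCayleyGraph p hp).A (θ x) at hθ
  have hex : ∀ g : Γ, ∃ c : ℂ, θ (MonoidAlgebra.single g 1) = c • MonoidAlgebra.single g 1 := by
    intro g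
    -- The case `K = ℂ` of the statement on homomorphisms into `ℂ[Γ] ⊗ K`.
    let φ : MonoidAlgebra ℂ Γ →ₐ[ℂ] MonoidAlgebra ℂ Γ ⊗[ℂ] ℂ :=
      (Algebra.TensorProduct.includeLeft : MonoidAlgebra ℂ Γ →ₐ[ℂ] MonoidAlgebra ℂ Γ ⊗[ℂ] ℂ).comp
        (θ : MonoidAlgebra ℂ Γ →⋆ₐ[ℂ] MonoidAlgebra ℂ Γ).toAlgHom
    have hφ : ∀ x, φ x = θ x ⊗ₜ[ℂ] (1 : ℂ) := fun _ => rfl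
    obtain ⟨a, ha⟩ := exists_eq_single_tmul hΓ hp hsep φ
      (fun x => by rw [hφ, hφ, LinearMap.rTensor_tmul, hθ]) g
    refine ⟨a, ?_⟩
    have h := congrArg (TensorProduct.rid ℂ (MonoidAlgebra ℂ Γ)) ha
    rwa [hφ, TensorProduct.rid_tmul, TensorProduct.rid_tmul, one_smul] at h
  choose χ hχ using hex
  have hinj : ∀ (g : Γ) {c d : ℂ},
      c • MonoidAlgebra.single g (1 : ℂ) = d • MonoidAlgebra.single g 1 → c = d := by
    intro g c d h
    simpa using congrArg (fun y => MonoidAlgebra.coeff y g) h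
  let f : Γ →* ℂ :=
    { toFun := χ
      map_one' := hinj 1 (by rw [← hχ, ← MonoidAlgebra.one_def, map_one, one_smul])
      map_mul' := fun g h => hinj (g * h) (by
        have h1 : MonoidAlgebra.single (g * h) (1 : ℂ)
            = MonoidAlgebra.single g 1 * MonoidAlgebra.single h 1 := by
          simp [MonoidAlgebra.single_mul_single]
        rw [← hχ, h1, map_mul, hχ, hχ, smul_mul_smul_comm]) }
  -- A character kills commutators, which generate the perfect group `Γ`.
  have hf : ∀ g, χ g = 1 := by
    intro g
    have h1 : g ∈ f.toHomUnits.ker :=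
      Abelianization.commutator_subset_ker f.toHomUnits (hΓ.commutator_eq_top ▸ Subgroup.mem_top g)
    exact congrArg Units.val (MonoidHom.mem_ker.mp h1)
  rw [Subgroup.mem_bot]
  ext1 x
  change θ x = x
  induction x using MonoidAlgebra.induction_linear with
  | zero => simp
  | add x y hx hy => rw [map_add, hx, hy]
  | single g c =>
    have h : MonoidAlgebra.single g c = c • MonoidAlgebra.single g (1 : ℂ) := by simp
    rw [h, map_smul, hχ, hf, one_smul]

theorem existsUnique_bialgHom (hΓ : Group.IsPerfect Γ) {p : MonoidAlgebra ℂ Γ}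
    (hp : IsStarProjection p)
    (hsep : ∀ g h x : Γ, ¬ Commute g x → h ≠ g → p.coeff h ≠ p.coeff g)
    {K : Type*} [Ring K] [StarRing K] [HopfAlgebra ℂ K] [StarModule ℂ K]
    (β : QuantumAction (MonoidAlgebra ℂ Γ) K) (hβ : (dualCayleyGraph p hp).IsPreservedBy β) :
    ∃! γ : MonoidAlgebra ℂ Γ →ₐc[ℂ] K, (∀ x, γ (star x) = star (γ x)) ∧
      ∀ x, LinearMap.lTensor (MonoidAlgebra ℂ Γ) (γ : MonoidAlgebra ℂ Γ →ₗ[ℂ] K)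
        ((QuantumAction.regular (MonoidAlgebra ℂ Γ)).hom x) = β.hom x := by
  have hex : ∀ g : Γ, ∃ a : K,
      β.hom (MonoidAlgebra.single g 1) = MonoidAlgebra.single g 1 ⊗ₜ[ℂ] a := fun g =>
    exists_eq_single_tmul hΓ hp hsep β.hom.toAlgHom hβ.adjacency g
  choose a ha using hex
  have hone : a 1 = 1 := single_tmul_injective (1 : Γ) (by
    rw [← ha, ← MonoidAlgebra.one_def, map_one, Algebra.TensorProduct.one_def])
  have hmul : ∀ g h, a (g * h) = a g * a h := fun g h => single_tmul_injective (g * h) (by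
    have h1 : MonoidAlgebra.single (g * h) (1 : ℂ)
        = MonoidAlgebra.single g 1 * MonoidAlgebra.single h 1 := by
      simp [MonoidAlgebra.single_mul_single]
    rw [← ha, h1, map_mul, ha, ha, Algebra.TensorProduct.tmul_mul_tmul])
  have hstar : ∀ g, a g⁻¹ = star (a g) := fun g => single_tmul_injective g⁻¹ (by
    have h1 : MonoidAlgebra.single g⁻¹ (1 : ℂ) = star (MonoidAlgebra.single g (1 : ℂ)) := by
      simp [groupAlgebra_star_single]
    rw [← ha, h1, map_star, ha, TensorProduct.star_tmul])
  -- Coassociativity of the action on `g` says exactly that `a g` is group-like.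
  have hcomul : ∀ g, Coalgebra.comul (R := ℂ) (a g) = a g ⊗ₜ[ℂ] a g := by
    intro g
    have h1 := β.action_eq (MonoidAlgebra.single g 1)
    rw [ha, LinearMap.rTensor_tmul, LinearMap.lTensor_tmul] at h1
    refine single_tmul_injective g (h1.symm.trans ?_)
    change TensorProduct.assoc ℂ _ K K (β.hom (MonoidAlgebra.single g 1) ⊗ₜ[ℂ] a g) = _
    rw [ha, TensorProduct.assoc_tmul]
  have hcounit : ∀ g, Coalgebra.counit (R := ℂ) (a g) = 1 := by
    intro g
    have h1 := Coalgebra.rTensor_counit_comul (R := ℂ) (a g)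
    rw [hcomul, LinearMap.rTensor_tmul] at h1
    have h2 := congrArg (TensorProduct.lid ℂ K) h1
    rw [TensorProduct.lid_tmul, TensorProduct.lid_tmul, one_smul] at h2
    -- The counit axiom gives only `ε (a g) • a g = a g`; invertibility of `a g` cancels it.
    have h3 := congrArg (fun y => Coalgebra.counit (R := ℂ) (y * a g⁻¹)) h2
    simpa [← hmul, hone] using h3
  let f : Γ →* K := { toFun := a, map_one' := hone, map_mul' := hmul }
  have hlift : ∀ (g : Γ) (c : ℂ),
      MonoidAlgebra.lift ℂ K Γ f (MonoidAlgebra.single g c) = c • a g := fun g c => by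
    rw [MonoidAlgebra.lift_single]
    rfl
  let γ : MonoidAlgebra ℂ Γ →ₐc[ℂ] K := BialgHom.ofAlgHom (MonoidAlgebra.lift ℂ K Γ f)
    (MonoidAlgebra.algHom_ext (fun g => by
      change Coalgebra.counit (R := ℂ) (MonoidAlgebra.lift ℂ K Γ f _)
        = Coalgebra.counit (R := ℂ) (MonoidAlgebra.single g (1 : ℂ))
      rw [hlift]
      simp [hcounit]) (Subsingleton.elim _ _))
    (MonoidAlgebra.algHom_ext (fun g => by
      change Algebra.TensorProduct.map _ _ (Coalgebra.comul (R := ℂ) _)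
        = Coalgebra.comul (R := ℂ) (MonoidAlgebra.lift ℂ K Γ f _)
      rw [hlift]
      simp [hcomul, hlift]) (Subsingleton.elim _ _))
  have hγ : ∀ (g : Γ) (c : ℂ), γ (MonoidAlgebra.single g c) = c • a g := hlift
  refine ⟨γ, ⟨fun x => ?_, fun x => ?_⟩, fun γ' hγ' => ?_⟩
  · induction x using MonoidAlgebra.induction_linear with
    | zero => simp
    | add x y hx hy => simp only [star_add, map_add, hx, hy]
    | single g c => rw [groupAlgebra_star_single, hγ, hγ, star_smul, hstar]
  · induction x using MonoidAlgebra.induction_linear with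
    | zero => simp
    | add x y hx hy => simp only [map_add, hx, hy]
    | single g c =>
      have h : MonoidAlgebra.single g c = c • MonoidAlgebra.single g (1 : ℂ) := by simp
      rw [regular_single, LinearMap.lTensor_tmul, h, map_smul, map_smul, ha,
        TensorProduct.tmul_smul]
      congr 2
      exact (hγ g 1).trans (one_smul _ _)
  · have h1 : ∀ g : Γ, γ' (MonoidAlgebra.single g 1) = γ (MonoidAlgebra.single g 1) := by
      intro g
      have h2 := hγ'.2 (MonoidAlgebra.single g 1)
      rw [regular_single, LinearMap.lTensor_tmul, ha] at h2
      rw [hγ, one_smul]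
      exact single_tmul_injective g h2
    refine BialgHom.ext fun x => ?_
    induction x using MonoidAlgebra.induction_linear with
    | zero => simp
    | add x y hx hy => rw [map_add, map_add, hx, hy]
    | single g c =>
      have h : MonoidAlgebra.single g c = c • MonoidAlgebra.single g (1 : ℂ) := by simp
      rw [h, map_smul, map_smul, h1]

end MainTheorem

theorem theoremC (Γ : Type u) [Group Γ] [Fintype Γ] (hΓ : Group.IsPerfect Γ) :
    ∃ G : QuantumGraph (dualQuantumSet Γ),
      G.IsCayley ∧
      G.classicalAut = ⊥ ∧
      QuantumGraph.IsQuantumAutGroup.{v} G (QuantumAction.regular (MonoidAlgebra ℂ Γ)) ∧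
      (QuantumAction.regular (MonoidAlgebra ℂ Γ)).IsErgodic := by
  obtain ⟨p, hp, hsep⟩ := exists_projection_separating Γ
  exact ⟨dualCayleyGraph p hp, ⟨p, hp, rfl⟩, classicalAut_dualCayleyGraph hΓ hp hsep,
    { compactQuantumGroup := inferInstance
      preserved := isPreservedBy_regular p hp
      faithful := isFaithful_regular_groupAlgebra
      universal := fun K _ _ _ _ _ β hβ => existsUnique_bialgHom hΓ hp hsep β hβ },
    isErgodic_regular_groupAlgebra⟩
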